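/- **Proposition.** Let $S$ be a (small) finite-limit sketch: a directed graph with a set of diagrams in it and a set of cones in it over finite diagrams. A *model* of $S$ in a category is a graph homomorphism from the graph of $S$ to it that takes the diagrams of $S$ to commutative diagrams and the cones of $S$ to limit cones. Let $\mathrm{CatTh}[\mathbf{FinLim},S]$ be the following category. Its objects are the finite diagrams $X$ in the image of the graph of $S$, that is, in the graph of $S$ with two parallel arrows identified when every model of $S$ in $\mathbf{Set}$ identifies them. An arrow $X\to Y$ is a family of functions $\lim (M\circ X)\to\lim (M\circ Y)$, one for each model $M$ of $S$ in $\mathbf{Set}$, natural in $M$. Let $U : S\to \mathrm{CatTh}[\mathbf{FinLim},S]$ send a node to the one-point diagram at it, and an arrow $f$ to the family $(M(f))_M$. Each object $X$ is the vertex of an evident cone over the diagram $U\circ X$ ("the formal cone of $X$"). 1. $\mathrm{CatTh}[\mathbf{FinLim},S]$ is a categorial theory of $S$ with universal model $U$: it has limits of finite diagrams, $U$ is a model of $S$, and for every model $M$ of $S$ in $\mathbf{Set}$ there is a finite-limit-preserving functor $F_M:\mathrm{CatTh}[\mathbf{FinLim},S]\to\mathbf{Set}$ with $F_M\circ U\cong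 M$, and $F_M$ is unique up to natural isomorphism. 2. $\mathrm{CatTh}[\mathbf{FinLim},S]$ has a system of canonical finite limits: a choice, for every finite diagram $\delta$ in it, of a limit cone $\mathrm{LimCone}[\delta]:\mathrm{Lim}[\delta]\triangleleft\delta$ such that $\mathrm{LimCone}[U\circ X]$ is the formal cone of $X$ for every object $X$ (so every object is the canonical limit of a diagram in the sketch). 3. Fix any such system, and call *canonical* the cones $\mathrm{LimCone}[\delta]$ and the images under $U$ of the cones of $S$. Then every object and every arrow of $\mathrm{CatTh}[\mathbf{FinLim},S]$ is obtained by repeated application of these rules: - ($\exists$OB) $U(c)$ is constructed, for every node $c$ of $S$; - ($\exists$ARR) $U(f)$ is constructed, for every arrow $f$ of $S$; - ($\exists$COMP) from $f:a\to b$ and $g:b\to c$ construct $g\circ f$; - ($\exists$ID) from an object $c$ construct $\mathrm{Id}[c]$; - ($\exists$LIM) from the objects and arrows of a finite diagram $\delta$ construct the vertex and the projections of the canonical limit cones over $\delta$; - ($\exists$FIA) from the objects and arrows of a finite diagram $\delta$, and the vertex and projections of a cone $\Theta$ over $\delta$ whose commutativity has been derived, construct the unique arrow from the vertex of $\Theta$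 to the vertex of a canonical limit cone over $\delta$ that commutes with the projections. Here the commutativity of a diagram that consists of two parallel paths of constructed arrows is derived by these rules: an arrow $f$ commutes with itself (REF); if $p,q$ commute and $r,q$ commute, then so do $p,r$ (TRANS); $U$ takes every diagram of $S$ to a commutative diagram ($\exists$DIAG); the path $f,g$ commutes with $g\circ f$ (COMPDIAG); the paths $g,\mathrm{Id}$ and $\mathrm{Id},g$ commute with $g$ (IDL, IDR); the path $f,\,h\circ g$ commutes with the path $g\circ f,\,h$ (ASSOC); canonical limit cones commute; the fill-in arrow of $\exists$FIA followed by a projection commutes with the corresponding projection of $\Theta$ (CFIA); and two arrows $h,k$ to the vertex of a canonical limit cone that both commute with its projections and those of one cone commute with each other (!FIA). In other words, the least collection of objects and arrows of $\mathrm{CatTh}[\mathbf{FinLim},S]$ that is closed under these rules consists of all of them: the rules define the theory recursively. -/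

import Mathlib

open CategoryTheory

universe u v w v₁ w₁

/-! ### Finite graphs, diagrams and cones -/

/-- A finite (directed multi-)graph, in standard form: the nodes are `0, …, nodes - 1`, and there
are `arrows i j` arrows from `i` to `j`. Every finite graph is isomorphic to one of this form. -/
structure FinGraph where
  nodes : ℕ
  arrows : Fin nodes → Fin nodes → ℕ

/-- The type of nodes of a finite graph. -/
def FinGraph.Node (I : FinGraph) : Type := Fin I.nodes

instance (I : FinGraph) : Quiver.{0} I.Node where
  Hom i j := Fin (I.arrows i j)

/-- The graph with one node and no arrows. -/
def FinGraph.point : FinGraph where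
  nodes := 1
  arrows _ _ := 0

/-- The node of the one-point graph. -/
def FinGraph.pointNode : FinGraph.point.Node := (0 : Fin 1)

/-- A (not necessarily commutative) cone in a graph `G` over a finite diagram `δ : I → G`: a vertex
and an arrow from it to `δ i` for each node `i` of `I`. -/
structure GCone {G : Type w} [Quiver.{v} G] {I : FinGraph} (δ : I.Node ⥤q G) where
  vertex : G
  proj : ∀ i : I.Node, vertex ⟶ δ.obj i

/-- The image of a cone under a graph homomorphism. -/
def GCone.map {G : Type w} [Quiver.{v} G] {H : Type w₁} [Quiver.{v₁} H] {I : FinGraph}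
    {δ : I.Node ⥤q G} (c : GCone δ) (F : G ⥤q H) : GCone (δ ⋙q F) where
  vertex := F.obj c.vertex
  proj i := F.map (c.proj i)

/-- A cone in a category is commutative. -/
def GCone.Commutes {C : Type w} [Category.{v} C] {I : FinGraph} {δ : I.Node ⥤q C}
    (c : GCone δ) : Prop :=
  ∀ (i j : I.Node) (a : i ⟶ j), c.proj i ≫ δ.map a = c.proj j

/-- A cone in a category is a limit cone: it is commutative, and every commutative cone over the
same diagram factors through it by exactly one arrow. -/
def GCone.IsLimit {C : Type w} [Category.{v} C] {I : FinGraph} {δ : I.Node ⥤q C}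
    (c : GCone δ) : Prop :=
  c.Commutes ∧ ∀ t : GCone δ, t.Commutes →
    ∃! h : t.vertex ⟶ c.vertex, ∀ i, h ≫ c.proj i = t.proj i

/-- A diagram in a category commutes: any two parallel paths of the shape graph have the same
composite (an empty path having an identity as its composite). -/
def DiagramCommutes {J : Type w₁} [Quiver.{v₁} J] {C : Type w} [Category.{v} C]
    (δ : J ⥤q C) : Prop :=
  ∀ (i j : J) (p q : Quiver.Path i j), composePath (δ.mapPath p) = composePath (δ.mapPath q)

/-- A functor preserves all limits of finite diagrams. -/
def PreservesFinLim {C : Type w} [Category.{v} C] {D : Type w₁} [Category.{v₁} D]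
    (F : C ⥤ D) : Prop :=
  ∀ (I : FinGraph) (δ : I.Node ⥤q C) (c : GCone δ), c.IsLimit → (c.map F.toPrefunctor).IsLimit

/-! ### Finite-limit sketches and their models -/

/-- A finite-limit sketch: a graph, a set of diagrams in it, and a set of cones in it over finite
diagrams. -/
structure FinLimSketch where
  Node : Type u
  [quiver : Quiver.{u} Node]
  DiagIdx : Type u
  diagShape : DiagIdx → Type u
  [diagQuiver : ∀ d, Quiver.{u} (diagShape d)]
  diag : ∀ d, diagShape d ⥤q Node
  ConeIdx : Type u
  coneShape : ConeIdx → FinGraph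
  coneBase : ∀ c, (coneShape c).Node ⥤q Node
  cone : ∀ c, GCone (coneBase c)

attribute [instance] FinLimSketch.quiver FinLimSketch.diagQuiver

namespace FinLimSketch

/-- A graph homomorphism from the graph of a sketch to a category is a model of the sketch: it
takes the diagrams to commutative diagrams and the cones to limit cones. -/
def IsModel (S : FinLimSketch.{u}) {C : Type w} [Category.{v} C] (M : S.Node ⥤q C) : Prop :=
  (∀ d, DiagramCommutes (S.diag d ⋙q M)) ∧ ∀ c, ((S.cone c).map M).IsLimit

/-- A model of a sketch in the category of sets. -/
structure SetModel (S : FinLimSketch.{u}) where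
  toPre : S.Node ⥤q Type u
  isModel : S.IsModel toPre

/-- A morphism of set-valued models. -/
structure SetModelHom {S : FinLimSketch.{u}} (M N : S.SetModel) where
  app : ∀ n : S.Node, M.toPre.obj n → N.toPre.obj n
  naturality : ∀ {a b : S.Node} (f : a ⟶ b) (x : M.toPre.obj a),
    app b (M.toPre.map f x) = N.toPre.map f (app a x)

/-! ### The categorial theory of a sketch

An object is a finite diagram of the form `UnivMod ∘ δ`, with `δ` a diagram in the graph of the
sketch; it stands for the limit of that diagram. An arrow from `X` to `Y` is an operation
`lim (M ∘ X) → lim (M ∘ Y)` given for all set-valued models `M` and natural in `M`. As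
`M ↦ lim (M ∘ X)` is represented by the model that is freely generated by an element of
`lim (M ∘ X)`, this is the opposite of the full subcategory of such finitely presented models. -/

/-- Two arrows of the graph of `S` are identified if every set-valued model identifies them. -/
def arrowSetoid (S : FinLimSketch.{u}) (a b : S.Node) : Setoid (a ⟶ b) where
  r f g := ∀ M : S.SetModel, M.toPre.map f = M.toPre.map g
  iseqv := ⟨fun _ _ => rfl, fun h M => (h M).symm, fun h k M => (h M).trans (k M)⟩

/-- The nodes of `S`, as nodes of the image of the graph of `S` in the theory. -/
def ImNode (S : FinLimSketch.{u}) : Type u := S.Node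

/-- The image of the graph of `S` in the theory: its arrows are those of `S`, up to the
identifications made by all models. -/
instance (S : FinLimSketch.{u}) : Quiver.{u} S.ImNode where
  Hom a b := Quotient (S.arrowSetoid a b)

/-- The graph homomorphism from the graph of `S` onto its image. -/
def toIm (S : FinLimSketch.{u}) : S.Node ⥤q S.ImNode where
  obj n := n
  map f := Quotient.mk _ f

/-- A set-valued model, on the image graph. -/
def SetModel.im {S : FinLimSketch.{u}} (M : S.SetModel) : S.ImNode ⥤q Type u where
  obj n := M.toPre.obj n
  map {a b} e := Quotient.lift (s := S.arrowSetoid a b) (fun f => M.toPre.map f)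
    (fun _ _ h => h M) e

/-- The objects of the theory. -/
structure Theory (S : FinLimSketch.{u}) where
  shape : FinGraph
  diag : shape.Node ⥤q S.ImNode

/-- The set `lim (M ∘ X)`, as the set of compatible families. -/
def Sec {S : FinLimSketch.{u}} (M : S.SetModel) (X : S.Theory) : Type u :=
  { x : ∀ i : X.shape.Node, M.im.obj (X.diag.obj i) //
    ∀ (i j : X.shape.Node) (a : i ⟶ j), M.im.map (X.diag.map a) (x i) = x j }

/-- A morphism of models is compatible with the arrows of the image graph. -/
theorem SetModelHom.im_naturality {S : FinLimSketch.{u}} {M N : S.SetModel}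
    (h : SetModelHom M N) {a b : S.ImNode} (e : a ⟶ b) (x : M.im.obj a) :
    h.app b (M.im.map e x) = N.im.map e (h.app a x) := by
  induction e using Quotient.inductionOn with
  | h f => exact h.naturality f x

/-- The function `lim (M ∘ X) → lim (N ∘ X)` induced by a morphism of models. -/
def SetModelHom.sec {S : FinLimSketch.{u}} {M N : S.SetModel} (h : SetModelHom M N)
    (X : S.Theory) (x : Sec M X) : Sec N X :=
  ⟨fun i => h.app _ (x.1 i), fun i j a => by rw [← h.im_naturality, x.2 i j a]⟩

/-- The arrows of the theory. -/
@[ext]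
structure TheoryHom {S : FinLimSketch.{u}} (X Y : S.Theory) where
  app : ∀ M : S.SetModel, Sec M X → Sec M Y
  naturality : ∀ {M N : S.SetModel} (h : SetModelHom M N) (x : Sec M X),
    app N (h.sec X x) = h.sec Y (app M x)

/-- The categorial theory of `S`. -/
instance (S : FinLimSketch.{u}) : Category.{u + 1} S.Theory where
  Hom X Y := TheoryHom X Y
  id _ := ⟨fun _ x => x, fun _ _ => rfl⟩
  comp f g := ⟨fun M x => g.app M (f.app M x), fun h x => by rw [f.naturality, g.naturality]⟩

/-- A node of `S` as an object of the theory: the limit of the one-point diagram. -/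
def single (S : FinLimSketch.{u}) (n : S.ImNode) : S.Theory where
  shape := FinGraph.point
  diag := { obj := fun _ => n, map := fun a => Fin.elim0 a }

/-- An element of `M n`, as a compatible family over the one-point diagram. -/
def secSingle {S : FinLimSketch.{u}} (M : S.SetModel) {n : S.ImNode} (x : M.im.obj n) :
    Sec M (S.single n) :=
  ⟨fun _ => x, fun _ _ a => Fin.elim0 a⟩

/-- The inclusion of the image graph of `S` in the theory. -/
def imIncl (S : FinLimSketch.{u}) : S.ImNode ⥤q S.Theory where
  obj n := S.single n
  map e := TheoryHom.mk (fun M x => secSingle M (M.im.map e (x.1 FinGraph.pointNode)))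
    (fun h _ => Subtype.ext (funext fun _ => (h.im_naturality e _).symm))

/-- The universal model of `S`. -/
def univMod (S : FinLimSketch.{u}) : S.Node ⥤q S.Theory := S.toIm ⋙q S.imIncl

/-- The diagram in the theory that an object of the theory is the formal limit of. -/
def Theory.diagram {S : FinLimSketch.{u}} (X : S.Theory) : X.shape.Node ⥤q S.Theory :=
  X.diag ⋙q S.imIncl

/-- The cone over that diagram which is given by the evident projections
`lim (M ∘ X) → M (X i)`. -/
def Theory.formalCone {S : FinLimSketch.{u}} (X : S.Theory) : GCone X.diagram where
  vertex := X
  proj i := TheoryHom.mk (fun M x => secSingle M (x.1 i)) (fun _ _ => rfl)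

/-- A category `C` with a graph homomorphism `U` to it from the graph of `S` is a categorial theory
of `S` with universal model `U`: `C` has limits of finite diagrams, `U` is a model, and every
set-valued model of `S` is, up to isomorphism, the restriction along `U` of a functor that
preserves finite limits, which is determined uniquely up to natural isomorphism. -/
structure IsCategorialTheory (S : FinLimSketch.{u}) {C : Type w} [Category.{v} C]
    (U : S.Node ⥤q C) : Prop where
  hasLimits : ∀ (I : FinGraph) (δ : I.Node ⥤q C), ∃ c : GCone δ, c.IsLimit
  isModel : S.IsModel U
  extend : ∀ M : S.SetModel, ∃ F : C ⥤ Type u, PreservesFinLim F ∧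
    ∃ φ : ∀ n : S.Node, F.obj (U.obj n) ≅ M.toPre.obj n,
      ∀ {a b : S.Node} (f : a ⟶ b),
        F.map (U.map f) ≫ (φ b).hom = (φ a).hom ≫ M.toPre.map f
  unique : ∀ F G : C ⥤ Type u, PreservesFinLim F → PreservesFinLim G →
    (∃ φ : ∀ n : S.Node, F.obj (U.obj n) ≅ G.obj (U.obj n),
      ∀ {a b : S.Node} (f : a ⟶ b),
        F.map (U.map f) ≫ (φ b).hom = (φ a).hom ≫ G.map (U.map f)) →
    Nonempty (F ≅ G)

/-- A choice of canonical finite limits in the theory: a limit cone `LimCone[δ]` for each finite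
diagram `δ`, such that the canonical limit of a diagram that comes from the graph of `S` is the
object of the theory that is that diagram. -/
structure CanonicalLimits (S : FinLimSketch.{u}) where
  limCone : ∀ {I : FinGraph} (δ : I.Node ⥤q S.Theory), GCone δ
  isLimit : ∀ {I : FinGraph} (δ : I.Node ⥤q S.Theory), (limCone δ).IsLimit
  formal : ∀ X : S.Theory, limCone X.diagram = X.formalCone

/-- The canonical limit cones of the theory: the cones `LimCone[δ]`, and the cones of `S`, which
the universal model, being a morphism of sketches, takes to canonical limit cones. -/
inductive IsCanonical {S : FinLimSketch.{u}} (L : S.CanonicalLimits) :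
    ∀ {I : FinGraph} {δ : I.Node ⥤q S.Theory}, GCone δ → Prop
  | lim {I : FinGraph} (δ : I.Node ⥤q S.Theory) : IsCanonical L (L.limCone δ)
  | sketch (c : S.ConeIdx) : IsCanonical L ((S.cone c).map S.univMod)

/-! ### The rules of construction

`ConstrOb L X` and `ConstrArr L f` say that the object `X` and the arrow `f` are obtained by
repeated application of the rules; `ConstrComm L p q` says that it follows by the rules that the
diagram consisting of the parallel paths `p` and `q` commutes. -/

mutual

/-- The objects that the rules construct. -/
inductive ConstrOb {S : FinLimSketch.{u}} (L : S.CanonicalLimits) : S.Theory → Prop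
  /-- Rule `∃OB`. -/
  | ob (c : S.Node) : ConstrOb L (S.univMod.obj c)
  /-- Rule `∃LIM`, the vertex. -/
  | lim {I : FinGraph} (δ : I.Node ⥤q S.Theory)
      (hob : ∀ i, ConstrOb L (δ.obj i))
      (harr : ∀ (i j : I.Node) (a : i ⟶ j), ConstrArr L (δ.map a))
      (c : GCone δ) (hc : IsCanonical L c) : ConstrOb L c.vertex

/-- The arrows that the rules construct. -/
inductive ConstrArr {S : FinLimSketch.{u}} (L : S.CanonicalLimits) :
    ∀ {X Y : S.Theory}, (X ⟶ Y) → Prop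
  /-- Rule `∃ARR`. -/
  | arr {a b : S.Node} (f : a ⟶ b) : ConstrArr L (S.univMod.map f)
  /-- Rule `∃COMP`. -/
  | comp {X Y Z : S.Theory} (f : X ⟶ Y) (g : Y ⟶ Z)
      (hf : ConstrArr L f) (hg : ConstrArr L g) : ConstrArr L (f ≫ g)
  /-- Rule `∃ID`. -/
  | id (X : S.Theory) (hX : ConstrOb L X) : ConstrArr L (𝟙 X)
  /-- Rule `∃LIM`, the projections. -/
  | proj {I : FinGraph} (δ : I.Node ⥤q S.Theory)
      (hob : ∀ i, ConstrOb L (δ.obj i))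
      (harr : ∀ (i j : I.Node) (a : i ⟶ j), ConstrArr L (δ.map a))
      (c : GCone δ) (hc : IsCanonical L c) (i : I.Node) : ConstrArr L (c.proj i)
  /-- Rule `∃FIA`: the fill-in arrow `h` of a commutative cone `t`. -/
  | fillin {I : FinGraph} (δ : I.Node ⥤q S.Theory)
      (hob : ∀ i, ConstrOb L (δ.obj i))
      (harr : ∀ (i j : I.Node) (a : i ⟶ j), ConstrArr L (δ.map a))
      (c : GCone δ) (hc : IsCanonical L c)
      (t : GCone δ) (hv : ConstrOb L t.vertex) (ht : ∀ i, ConstrArr L (t.proj i))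
      (hcomm : ∀ (i j : I.Node) (a : i ⟶ j),
        ConstrComm L ((t.proj i).toPath.cons (δ.map a)) (t.proj j).toPath)
      (h : t.vertex ⟶ c.vertex) (hh : ∀ i, h ≫ c.proj i = t.proj i) : ConstrArr L h

/-- The commutative diagrams that the rules construct. -/
inductive ConstrComm {S : FinLimSketch.{u}} (L : S.CanonicalLimits) :
    ∀ {X Y : S.Theory}, Quiver.Path X Y → Quiver.Path X Y → Prop
  /-- Rule `REF`. -/
  | ref {X Y : S.Theory} (f : X ⟶ Y) (hf : ConstrArr L f) : ConstrComm L f.toPath f.toPath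
  /-- Rule `TRANS`. -/
  | trans {X Y : S.Theory} (p q r : Quiver.Path X Y)
      (hpq : ConstrComm L p q) (hrq : ConstrComm L r q) : ConstrComm L p r
  /-- Rule `∃DIAG`. -/
  | diag (d : S.DiagIdx) (i j : S.diagShape d) (p q : Quiver.Path i j) :
      ConstrComm L ((S.diag d ⋙q S.univMod).mapPath p) ((S.diag d ⋙q S.univMod).mapPath q)
  /-- Rule `COMPDIAG`. -/
  | compdiag {X Y Z : S.Theory} (f : X ⟶ Y) (g : Y ⟶ Z)
      (hf : ConstrArr L f) (hg : ConstrArr L g) :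
      ConstrComm L (f.toPath.cons g) (f ≫ g).toPath
  /-- Rule `IDL`. -/
  | idl {X Y : S.Theory} (g : X ⟶ Y) (hY : ConstrOb L Y) (hg : ConstrArr L g) :
      ConstrComm L (g.toPath.cons (𝟙 Y)) g.toPath
  /-- Rule `IDR`. -/
  | idr {X Y : S.Theory} (f : X ⟶ Y) (hX : ConstrOb L X) (hf : ConstrArr L f) :
      ConstrComm L ((𝟙 X : X ⟶ X).toPath.cons f) f.toPath
  /-- Rule `ASSOC`. -/
  | assoc {W X Y Z : S.Theory} (f : W ⟶ X) (g : X ⟶ Y) (h : Y ⟶ Z)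
      (hf : ConstrArr L f) (hg : ConstrArr L g) (hh : ConstrArr L h) :
      ConstrComm L (f.toPath.cons (g ≫ h)) ((f ≫ g).toPath.cons h)
  /-- Rule `∃LIM`, commutativity of the canonical limit cone. -/
  | lim {I : FinGraph} (δ : I.Node ⥤q S.Theory)
      (hob : ∀ i, ConstrOb L (δ.obj i))
      (harr : ∀ (i j : I.Node) (a : i ⟶ j), ConstrArr L (δ.map a))
      (c : GCone δ) (hc : IsCanonical L c) (i j : I.Node) (a : i ⟶ j) :
      ConstrComm L ((c.proj i).toPath.cons (δ.map a)) (c.proj j).toPath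
  /-- Rule `CFIA`: the fill-in arrow commutes with the projections. -/
  | cfia {I : FinGraph} (δ : I.Node ⥤q S.Theory)
      (hob : ∀ i, ConstrOb L (δ.obj i))
      (harr : ∀ (i j : I.Node) (a : i ⟶ j), ConstrArr L (δ.map a))
      (c : GCone δ) (hc : IsCanonical L c)
      (t : GCone δ) (hv : ConstrOb L t.vertex) (ht : ∀ i, ConstrArr L (t.proj i))
      (hcomm : ∀ (i j : I.Node) (a : i ⟶ j),
        ConstrComm L ((t.proj i).toPath.cons (δ.map a)) (t.proj j).toPath)
      (h : t.vertex ⟶ c.vertex) (hh : ∀ i, h ≫ c.proj i = t.proj i) (i : I.Node) :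
      ConstrComm L (h.toPath.cons (c.proj i)) (t.proj i).toPath
  /-- Rule `!FIA`: two arrows that commute with the projections are equal. -/
  | unique_fia {I : FinGraph} (δ : I.Node ⥤q S.Theory)
      (hob : ∀ i, ConstrOb L (δ.obj i))
      (harr : ∀ (i j : I.Node) (a : i ⟶ j), ConstrArr L (δ.map a))
      (c : GCone δ) (hc : IsCanonical L c)
      (t : GCone δ) (hv : ConstrOb L t.vertex) (ht : ∀ i, ConstrArr L (t.proj i))
      (h k : t.vertex ⟶ c.vertex) (hh : ConstrArr L h) (hk : ConstrArr L k)
      (hcommh : ∀ i, ConstrComm L (h.toPath.cons (c.proj i)) (t.proj i).toPath)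
      (hcommk : ∀ i, ConstrComm L (k.toPath.cons (c.proj i)) (t.proj i).toPath) :
      ConstrComm L h.toPath k.toPath

end

end FinLimSketch

/-!
The theory is controlled by its arrows to the nodes of `S`. The arrows from `X` to nodes that are
generated from the projections of `X` by the arrows and the cones of `S` form a set-valued model,
which has a generic element of `lim (M ∘ X)`: the family of the projections. An arrow from `X` to a
node is natural in the model, so it is determined by its value at the generic element, and this
value is a generated arrow that equals it. Hence all arrows to nodes are generated, and an arrow to
`Y` is the fill-in of its composites with the projections of `Y`. So the rules construct every
arrow, and functors that preserve finite limits are determined by their restrictions along the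
universal model.

By induction on the generation, the graph of an arrow to a node is defined by a finite system of
equations in which the values of the auxiliary variables are unique. The solutions of such a system
in a model `M` are the elements of `lim (M ∘ Z)` for an object `Z` of the theory. Hence every finite
diagram in the theory has a limit cone that evaluation at every model preserves.
-/

theorem exists_pi_extension {α β : Type*} {P : β → Type*} [∀ b, Nonempty (P b)] {f : α → β}
    (hf : f.Injective) (k : ∀ a, P (f a)) : ∃ g : ∀ b, P b, ∀ a, g (f a) = k a := by
  have hex (b : β) : ∃ y : P b, ∀ (a : α) (h : f a = b), h ▸ k a = y := by
    by_cases hb : ∃ a, f a = b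
    · obtain ⟨a, rfl⟩ := hb
      refine ⟨k a, fun a' h => ?_⟩
      obtain rfl := hf h
      rfl
    · exact ⟨Classical.arbitrary _, fun a h => (hb ⟨a, h⟩).elim⟩
  choose g hg using hex
  exact ⟨g, fun a => (hg (f a) a rfl).symm⟩

/-! ### Limit cones -/

section LimitCones

variable {C : Type w} [Category.{v} C] {D : Type w₁} [Category.{v₁} D] {I : FinGraph}
  {δ : I.Node ⥤q C} {c c' : GCone δ}

theorem GCone.IsLimit.hom_ext (hc : c.IsLimit) {X : C} {f g : X ⟶ c.vertex}
    (h : ∀ i, f ≫ c.proj i = g ≫ c.proj i) : f = g :=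
  (hc.2 ⟨X, fun i => g ≫ c.proj i⟩ fun i j a => by
    rw [Category.assoc, hc.1 i j a]).unique h fun _ => rfl

theorem GCone.IsLimit.exists_iso (hc : c.IsLimit) (hc' : c'.IsLimit) :
    ∃ e : c.vertex ≅ c'.vertex, ∀ i, e.hom ≫ c'.proj i = c.proj i := by
  obtain ⟨f, hf, -⟩ := hc'.2 c hc.1
  obtain ⟨g, hg, -⟩ := hc.2 c' hc'.1
  exact ⟨⟨f, g, hc.hom_ext fun i => by rw [Category.assoc, hg, hf, Category.id_comp],
    hc'.hom_ext fun i => by rw [Category.assoc, hf, hg, Category.id_comp]⟩, hf⟩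

theorem GCone.IsLimit.of_iso (hc : c.IsLimit) (e : c.vertex ≅ c'.vertex)
    (he : ∀ i, e.hom ≫ c'.proj i = c.proj i) : c'.IsLimit := by
  have he' (i : I.Node) : e.inv ≫ c.proj i = c'.proj i := by rw [Iso.inv_comp_eq, he]
  refine ⟨fun i j a => by rw [← he', ← he', Category.assoc, hc.1 i j a], fun t ht => ?_⟩
  obtain ⟨k, hk, hk'⟩ := hc.2 t ht
  refine ⟨k ≫ e.hom, fun i => by rw [Category.assoc, he, hk], fun l hl => ?_⟩
  rw [← Iso.comp_inv_eq]
  exact hk' _ fun i => by rw [Category.assoc, he', hl]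

theorem preservesFinLim_of_exists {F : C ⥤ D}
    (h : ∀ (I : FinGraph) (δ : I.Node ⥤q C), ∃ c : GCone δ,
      c.IsLimit ∧ (c.map F.toPrefunctor).IsLimit) : PreservesFinLim F := by
  intro I δ c hc
  obtain ⟨c₀, hc₀, hF⟩ := h I δ
  obtain ⟨e, he⟩ := hc₀.exists_iso hc
  exact hF.of_iso (F.mapIso e) fun i => (F.map_comp _ _).symm.trans (congrArg F.map (he i))

theorem GCone.isLimit_type_iff {δ : I.Node ⥤q Type w} (c : GCone δ) :
    c.IsLimit ↔ c.Commutes ∧ ∀ x : (∀ i, δ.obj i),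
      (∀ (i j : I.Node) (a : i ⟶ j), δ.map a (x i) = x j) →
        ∃! z : c.vertex, ∀ i, c.proj i z = x i := by
  refine and_congr_right fun _ => ⟨fun h x hx => ?_, fun h t ht => ?_⟩
  · obtain ⟨k, hk, hk'⟩ := h ⟨PUnit, fun i => ↾fun _ => x i⟩
      (fun i j a => by ext; exact hx i j a)
    refine ⟨k PUnit.unit, fun i => ConcreteCategory.congr_hom (hk i) PUnit.unit, fun z hz => ?_⟩
    exact ConcreteCategory.congr_hom
      (hk' (↾fun _ => z) fun i => by ext; exact hz i) PUnit.unit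
  · choose k hk hk' using fun y : t.vertex => h (fun i => t.proj i y)
      (fun i j a => ConcreteCategory.congr_hom (ht i j a) y)
    refine ⟨↾k, fun i => by ext y; exact hk y i, fun l hl => ?_⟩
    ext y
    exact hk' y _ fun i => ConcreteCategory.congr_hom (hl i) y

theorem preservesFinLim_coyoneda (X : C) : PreservesFinLim (coyoneda.obj (.op X)) := by
  intro I δ c hc
  refine (GCone.isLimit_type_iff _).2 ⟨fun i j a => ?_, fun x hx => hc.2 ⟨X, x⟩ hx⟩
  ext f
  exact (Category.assoc _ _ _).trans (congrArg (f ≫ ·) (hc.1 i j a))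

end LimitCones

/-! ### Commutative diagrams -/

section Diagrams

variable {J : Type*} [Quiver J]

theorem map_composePath {C : Type w} [Category.{v} C] {D : Type w₁} [Category.{v₁} D]
    (F : C ⥤ D) (δ : J ⥤q C) {i j : J} (p : Quiver.Path i j) :
    F.map (composePath (δ.mapPath p)) = composePath ((δ ⋙q F.toPrefunctor).mapPath p) := by
  induction p with
  | nil => exact F.map_id _
  | cons p e ih => exact (F.map_comp _ _).trans (congrArg (· ≫ F.map (δ.map e)) ih)

theorem composePath_naturality {M : J ⥤q Type w} {N : J ⥤q Type w₁} {ι : ∀ n, M.obj n → N.obj n}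
    (nat : ∀ {a b : J} (f : a ⟶ b) (x : M.obj a), ι b (M.map f x) = N.map f (ι a x))
    {i j : J} (p : Quiver.Path i j) (x : M.obj i) :
    ι j (composePath (M.mapPath p) x) = composePath (N.mapPath p) (ι i x) := by
  induction p with
  | nil => rfl
  | cons p e ih => exact (nat e _).trans (congrArg (N.map e) ih)

end Diagrams

namespace FinLimSketch

variable {S : FinLimSketch.{u}}

theorem IsModel.comp {C : Type w} [Category.{v} C] {D : Type w₁} [Category.{v₁} D]
    {M : S.Node ⥤q C} (hM : S.IsModel M) {F : C ⥤ D} (hF : PreservesFinLim F) :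
    S.IsModel (M ⋙q F.toPrefunctor) := by
  refine ⟨fun d i j p q => ?_, fun c => hF _ _ _ (hM.2 c)⟩
  exact (map_composePath F (S.diag d ⋙q M) p).symm.trans
    ((congrArg F.map (hM.1 d i j p q)).trans (map_composePath F (S.diag d ⋙q M) q))

theorem IsModel.of_injective {M : S.Node ⥤q Type w} {N : S.Node ⥤q Type w₁} (hN : S.IsModel N)
    (ι : ∀ n, M.obj n → N.obj n) (hι : ∀ n, (ι n).Injective)
    (nat : ∀ {a b : S.Node} (f : a ⟶ b) (x : M.obj a), ι b (M.map f x) = N.map f (ι a x))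
    (fill : ∀ (c : S.ConeIdx) (z : N.obj (S.cone c).vertex),
      (∀ i, N.map ((S.cone c).proj i) z ∈ Set.range (ι _)) → z ∈ Set.range (ι _)) :
    S.IsModel M := by
  refine ⟨fun d i j p q => ?_, fun c => (GCone.isLimit_type_iff _).2 ⟨fun i j a => ?_, ?_⟩⟩
  · ext x
    have hpath (r : Quiver.Path i j) := composePath_naturality (M := S.diag d ⋙q M)
      (N := S.diag d ⋙q N) (fun f => nat ((S.diag d).map f)) r x
    exact hι _ ((hpath p).trans
      ((ConcreteCategory.congr_hom (hN.1 d i j p q) _).trans (hpath q).symm))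
  · ext x
    apply hι
    have hcomm := ConcreteCategory.congr_hom ((hN.2 c).1 i j a) (ι _ x)
    exact (nat _ _).trans ((congrArg _ (nat _ x)).trans (hcomm.trans (nat _ x).symm))
  · intro x hx
    obtain ⟨z, hz, hz'⟩ := ((GCone.isLimit_type_iff _).1 (hN.2 c)).2 (fun i => ι _ (x i))
      fun i j a => (nat _ _).symm.trans (congrArg (ι _) (hx i j a))
    obtain ⟨y, rfl⟩ := fill c z fun i => ⟨x i, (hz i).symm⟩
    refine ⟨y, fun i => hι _ ((nat _ y).trans (hz i)), fun y' hy' => hι _ (hz' _ fun i => ?_)⟩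
    exact (nat _ y').symm.trans (congrArg (ι _) (hy' i))

/-! ### Evaluation of the theory at a model -/

/-- The operation `lim (M ∘ X) → lim (M ∘ Y)` that an arrow of the theory is at the model `M`. -/
def Theory.act {X Y : S.Theory} (f : X ⟶ Y) (M : S.SetModel) : Sec M X → Sec M Y :=
  TheoryHom.app f M

theorem Theory.hom_ext {X Y : S.Theory} {f g : X ⟶ Y}
    (h : ∀ M x, Theory.act f M x = Theory.act g M x) : f = g :=
  TheoryHom.ext (funext fun M => funext fun x => h M x)

theorem Theory.act_naturality {X Y : S.Theory} (f : X ⟶ Y) {M N : S.SetModel}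
    (h : SetModelHom M N) (x : Sec M X) :
    Theory.act f N (h.sec X x) = h.sec Y (Theory.act f M x) :=
  TheoryHom.naturality f h x

/-- Evaluation of the theory at a model: the functor `X ↦ lim (M ∘ X)`. -/
def evalAt (M : S.SetModel) : S.Theory ⥤ Type u where
  obj X := Sec M X
  map f := ↾(Theory.act f M)
  map_id _ := rfl
  map_comp _ _ := rfl

theorem isLimit_of_evalAt {I : FinGraph} {δ : I.Node ⥤q S.Theory} (c : GCone δ)
    (h : ∀ M : S.SetModel, (c.map (evalAt M).toPrefunctor).IsLimit) : c.IsLimit := by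
  have hlim (M : S.SetModel) := (GCone.isLimit_type_iff _).1 (h M)
  refine ⟨fun i j a => Theory.hom_ext fun M x =>
    ConcreteCategory.congr_hom ((hlim M).1 i j a) x, fun t ht => ?_⟩
  choose k hk hk' using fun (M : S.SetModel) (y : Sec M t.vertex) =>
    (hlim M).2 (fun i => Theory.act (t.proj i) M y)
      fun i j a => congrArg (fun g => Theory.act g M y) (ht i j a)
  have k_natural {M N : S.SetModel} (f : SetModelHom M N) (x : Sec M t.vertex) :
      k N (f.sec _ x) = f.sec _ (k M x) :=
    (hk' N _ _ fun i => (Theory.act_naturality (c.proj i) f (k M x)).trans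
      ((congrArg (f.sec _) (hk M x i)).trans (Theory.act_naturality (t.proj i) f x).symm)).symm
  exact ⟨TheoryHom.mk k k_natural, fun i => Theory.hom_ext fun M x => hk M x i,
    fun l hl => Theory.hom_ext fun M x => hk' M x _ fun i =>
      congrArg (fun g => Theory.act g M x) (hl i)⟩

theorem isModel_of_evalAt {U : S.Node ⥤q S.Theory}
    (h : ∀ M : S.SetModel, S.IsModel (U ⋙q (evalAt M).toPrefunctor)) : S.IsModel U := by
  refine ⟨fun d i j p q => Theory.hom_ext fun M x => ?_,
    fun c => isLimit_of_evalAt _ fun M => (h M).2 c⟩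
  have hmap (r : Quiver.Path i j) := map_composePath (evalAt M) (S.diag d ⋙q U) r
  exact ConcreteCategory.congr_hom ((hmap p).trans (((h M).1 d i j p q).trans (hmap q).symm)) x

theorem secSingle_eta {M : S.SetModel} {n : S.ImNode} (x : Sec M (S.single n)) :
    secSingle M (x.1 FinGraph.pointNode) = x :=
  Subtype.ext (funext fun i => by
    rw [Subsingleton.elim (α := Fin 1) i FinGraph.pointNode]
    rfl)

/-- Evaluation at `M` restricts to `M` along the universal model. -/
def evalAtUnivModIso (M : S.SetModel) (n : S.Node) :
    (evalAt M).obj (S.univMod.obj n) ≅ M.toPre.obj n where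
  hom := ↾fun x : Sec M (S.single n) => x.1 FinGraph.pointNode
  inv := ↾fun x => secSingle (n := n) M x
  hom_inv_id := by
    ext x
    exact secSingle_eta (n := n) x
  inv_hom_id := rfl

theorem univMod_isModel (S : FinLimSketch.{u}) : S.IsModel S.univMod :=
  isModel_of_evalAt fun M => M.isModel.of_injective (fun n => (evalAtUnivModIso M n).hom)
    (fun _ => ((isIso_iff_bijective _).1 inferInstance).1) (fun _ _ => rfl)
    fun _ z _ => ⟨(evalAtUnivModIso M _).inv z, rfl⟩

/-! ### Arrows to the nodes -/

/-- The value at `M` of an arrow to a node, as a function `lim (M ∘ X) → M n`. -/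
def Theory.val {X : S.Theory} {n : S.ImNode} (f : X ⟶ S.single n) (M : S.SetModel)
    (x : Sec M X) : M.im.obj n :=
  (Theory.act f M x).1 FinGraph.pointNode

theorem Theory.hom_single_ext {X : S.Theory} {n : S.ImNode} {f g : X ⟶ S.single n}
    (h : ∀ M x, Theory.val f M x = Theory.val g M x) : f = g :=
  Theory.hom_ext fun M x =>
    (secSingle_eta _).symm.trans ((congrArg (secSingle M) (h M x)).trans (secSingle_eta _))

theorem Theory.val_naturality {X : S.Theory} {n : S.ImNode} (f : X ⟶ S.single n)
    {M N : S.SetModel} (h : SetModelHom M N) (x : Sec M X) :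
    Theory.val f N (h.sec X x) = h.app n (Theory.val f M x) :=
  congrArg (fun y : Sec N (S.single n) => y.1 FinGraph.pointNode) (Theory.act_naturality f h x)

/-- The node of `S` at a point of the diagram `X`. -/
def Theory.label (X : S.Theory) (i : X.shape.Node) : S.Node := X.diag.obj i

/-- An arrow of `S` that represents the given arrow of the diagram `X`. -/
noncomputable def Theory.arrow (X : S.Theory) {i j : X.shape.Node} (a : i ⟶ j) :
    X.label i ⟶ X.label j :=
  (X.diag.map a).out

theorem Theory.toIm_map_arrow (X : S.Theory) {i j : X.shape.Node} (a : i ⟶ j) :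
    S.toIm.map (X.arrow a) = X.diag.map a :=
  Quotient.out_eq _

theorem Theory.univMod_map_arrow (X : S.Theory) {i j : X.shape.Node} (a : i ⟶ j) :
    S.univMod.map (X.arrow a) = X.diagram.map a :=
  congrArg S.imIncl.map (X.toIm_map_arrow a)

theorem SetModel.map_arrow (M : S.SetModel) (X : S.Theory) {i j : X.shape.Node} (a : i ⟶ j) :
    M.toPre.map (X.arrow a) = M.im.map (X.diag.map a) :=
  congrArg M.im.map (X.toIm_map_arrow a)

/-- The `i`-th projection from the formal limit `X`. -/
def Theory.proj (X : S.Theory) (i : X.shape.Node) : X ⟶ S.univMod.obj (X.label i) :=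
  X.formalCone.proj i

theorem Theory.formalCone_isLimit (X : S.Theory) : X.formalCone.IsLimit := by
  refine isLimit_of_evalAt _ fun M => (GCone.isLimit_type_iff _).2 ⟨fun i j a => ?_, fun x hx => ?_⟩
  · ext y
    exact congrArg (secSingle M) (y.2 i j a)
  · have point_congr {n : S.ImNode} {y z : Sec M (S.single n)} (h : y = z) :
        y.1 FinGraph.pointNode = z.1 FinGraph.pointNode :=
      congrArg (fun s : Sec M (S.single n) => s.1 FinGraph.pointNode) h
    exact ⟨⟨fun i => (x i).1 FinGraph.pointNode, fun i j a => point_congr (hx i j a)⟩,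
      fun i => secSingle_eta _, fun z hz => Subtype.ext (funext fun i => point_congr (hz i))⟩

theorem Theory.proj_comp_arrow (X : S.Theory) {i j : X.shape.Node} (a : i ⟶ j) :
    X.proj i ≫ S.univMod.map (X.arrow a) = X.proj j :=
  (congrArg (X.proj i ≫ ·) (X.univMod_map_arrow a)).trans (X.formalCone_isLimit.1 i j a)

/-! ### The model generated by an object of the theory -/

section GeneratedModel

variable {X : S.Theory} {n : S.Node} {M : S.SetModel}

/-- The terms built with the arrows and the cones of `S` from variables that stand for the
projections of `X`. They bound the size of the collection of arrows that they denote. -/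
inductive GenTerm (X : S.Theory) : S.Node → Type u
  | var (i : X.shape.Node) : GenTerm X (X.label i)
  | app {a b : S.Node} (f : a ⟶ b) (t : GenTerm X a) : GenTerm X b
  | fill (c : S.ConeIdx) (t : ∀ i, GenTerm X ((S.coneBase c).obj i)) : GenTerm X (S.cone c).vertex

/-- The term denotes the given arrow of the theory. A relation, since `fill` denotes an arrow only
if its arguments denote a commutative cone. -/
def GenTerm.Denotes : ∀ {n : S.Node}, GenTerm X n → (X ⟶ S.univMod.obj n) → Prop
  | _, .var i, g => g = X.proj i
  | _, .app f t, g => ∃ k, t.Denotes k ∧ g = k ≫ S.univMod.map f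
  | _, .fill c t, g => ∀ i, (t i).Denotes (g ≫ S.univMod.map ((S.cone c).proj i))

theorem GenTerm.Denotes.unique {t : GenTerm X n} {g g' : X ⟶ S.univMod.obj n} (h : t.Denotes g)
    (h' : t.Denotes g') : g = g' := by
  induction t with
  | var i => exact Eq.trans h (Eq.symm h')
  | app f t ih =>
    obtain ⟨k, hk, rfl⟩ := h
    obtain ⟨k', hk', rfl⟩ := h'
    rw [ih hk hk']
  | fill c t ih => exact (S.univMod_isModel.2 c).hom_ext fun i => ih i (h i) (h' i)

/-- The arrows from `X` to a node that are denoted by a term. -/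
def GenHom (X : S.Theory) (n : S.Node) : Type (u + 1) :=
  { g : X ⟶ S.univMod.obj n // ∃ t : GenTerm X n, t.Denotes g }

instance (X : S.Theory) (n : S.Node) : Small.{u} (GenHom X n) := by
  choose t ht using fun g : GenHom X n => g.2
  exact small_of_injective (f := t) fun g g' h => Subtype.ext ((ht g).unique (h ▸ ht g'))

/-- The arrow that an element of the model generated by `X` stands for. -/
noncomputable def genArrow (k : Shrink.{u} (GenHom X n)) : X ⟶ S.univMod.obj n :=
  ((equivShrink (GenHom X n)).symm k).1

theorem genArrow_injective :
    Function.Injective (genArrow : Shrink.{u} (GenHom X n) → (X ⟶ S.univMod.obj n)) :=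
  Subtype.val_injective.comp (equivShrink (GenHom X n)).symm.injective

theorem exists_denotes_genArrow (k : Shrink.{u} (GenHom X n)) :
    ∃ t : GenTerm X n, t.Denotes (genArrow k) :=
  ((equivShrink (GenHom X n)).symm k).2

/-- The element of the model generated by `X` that stands for the given arrow. -/
noncomputable def genMk (g : X ⟶ S.univMod.obj n) (h : ∃ t : GenTerm X n, t.Denotes g) :
    Shrink.{u} (GenHom X n) :=
  equivShrink _ ⟨g, h⟩

theorem genArrow_genMk (g : X ⟶ S.univMod.obj n) (h : ∃ t : GenTerm X n, t.Denotes g) :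
    genArrow (genMk g h) = g :=
  congrArg Subtype.val ((equivShrink (GenHom X n)).symm_apply_apply ⟨g, h⟩)

/-- The graph homomorphism underlying the model generated by `X`. -/
noncomputable def genPre (X : S.Theory) : S.Node ⥤q Type u where
  obj n := Shrink.{u} (GenHom X n)
  map f := ↾fun k => genMk (genArrow k ≫ S.univMod.map f)
    ((exists_denotes_genArrow k).imp' (GenTerm.app f) fun _ ht => ⟨_, ht, rfl⟩)

theorem genArrow_map {a b : S.Node} (f : a ⟶ b) (k : (genPre X).obj a) :
    genArrow ((genPre X).map f k) = genArrow k ≫ S.univMod.map f :=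
  genArrow_genMk _ _

theorem genPre_isModel (X : S.Theory) : S.IsModel (genPre X) := by
  refine (S.univMod_isModel.comp (preservesFinLim_coyoneda X)).of_injective (fun _ => genArrow)
    (fun _ => genArrow_injective) genArrow_map fun c g hg => ?_
  have hden (i) : ∃ t : GenTerm X _, t.Denotes (g ≫ S.univMod.map ((S.cone c).proj i)) := by
    obtain ⟨k, hk : genArrow k = g ≫ S.univMod.map ((S.cone c).proj i)⟩ := hg i
    exact hk ▸ exists_denotes_genArrow k
  choose t ht using hden
  exact ⟨genMk g ⟨.fill c t, ht⟩, genArrow_genMk _ _⟩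

/-- The model of `S` generated by an element of `lim (M ∘ X)`. -/
noncomputable def genModel (X : S.Theory) : S.SetModel := ⟨genPre X, genPre_isModel X⟩

/-- The generic element of `lim (M ∘ X)`, with `M` the model generated by `X`. -/
noncomputable def genSec (X : S.Theory) : Sec (genModel X) X :=
  ⟨fun i => genMk (X.proj i) ⟨.var i, rfl⟩, fun i j a => by
    rw [← SetModel.map_arrow]
    refine genArrow_injective ((genArrow_map (X.arrow a) _).trans ?_)
    exact (congrArg (· ≫ S.univMod.map (X.arrow a)) (genArrow_genMk _ _)).trans
      ((X.proj_comp_arrow a).trans (genArrow_genMk _ _).symm)⟩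

/-- The morphism from the model generated by `X` that takes the generic element to `x`. -/
noncomputable def genEval (x : Sec M X) : SetModelHom (genModel X) M where
  app _ k := Theory.val (genArrow k) M x
  naturality f k := congrArg (fun g => Theory.val g M x) (genArrow_map f k)

theorem genEval_genSec (x : Sec M X) : (genEval x).sec X (genSec X) = x :=
  Subtype.ext <| funext fun i =>
    congrArg (fun g => Theory.val g M x) (genArrow_genMk (X.proj i) ⟨.var i, rfl⟩)

theorem genArrow_val_genSec (g : X ⟶ S.univMod.obj n) :
    genArrow (Theory.val g (genModel X) (genSec X)) = g :=
  Theory.hom_single_ext fun M x => by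
    conv_rhs => rw [← genEval_genSec x]
    exact (Theory.val_naturality g (genEval x) (genSec X)).symm

theorem hom_node_induction {P : ∀ n : S.Node, (X ⟶ S.univMod.obj n) → Prop}
    (proj : ∀ i, P (X.label i) (X.proj i))
    (arr : ∀ {a b : S.Node} (f : a ⟶ b) (g : X ⟶ S.univMod.obj a),
      P a g → P b (g ≫ S.univMod.map f))
    (fill : ∀ (c : S.ConeIdx) (g : X ⟶ S.univMod.obj (S.cone c).vertex),
      (∀ i, P _ (g ≫ S.univMod.map ((S.cone c).proj i))) → P _ g)
    (g : X ⟶ S.univMod.obj n) : P n g := by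
  obtain ⟨t, ht⟩ : ∃ t : GenTerm X n, t.Denotes g :=
    genArrow_val_genSec g ▸ exists_denotes_genArrow _
  induction t with
  | var i => exact ht ▸ proj i
  | app f t ih =>
    obtain ⟨k, hk, rfl⟩ := ht
    exact arr f k (ih k hk)
  | fill c t ih => exact fill c g fun i => ih i _ (ht i)

end GeneratedModel

/-! ### The rules construct everything -/

section Rules

variable (L : S.CanonicalLimits)

theorem constrArr_diagram (X : S.Theory) (i j : X.shape.Node) (a : i ⟶ j) :
    ConstrArr L (X.diagram.map a) :=
  X.univMod_map_arrow a ▸ .arr _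

theorem isCanonical_formalCone (X : S.Theory) : IsCanonical L X.formalCone :=
  L.formal X ▸ .lim _

theorem constrOb (X : S.Theory) : ConstrOb L X :=
  .lim X.diagram (fun i => .ob (X.label i)) (constrArr_diagram L X) _ (isCanonical_formalCone L X)

theorem constrArr_of_comp_proj {I : FinGraph} {δ : I.Node ⥤q S.Theory}
    (harr : ∀ (i j : I.Node) (a : i ⟶ j), ConstrArr L (δ.map a))
    {c : GCone δ} (hc : IsCanonical L c) (hcomm : c.Commutes) {X : S.Theory} (g : X ⟶ c.vertex)
    (hg : ∀ i, ConstrArr L (g ≫ c.proj i)) : ConstrArr L g := by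
  refine .fillin δ (fun i => constrOb L _) harr c hc ⟨X, fun i => g ≫ c.proj i⟩ (constrOb L X)
    hg (fun i j a => ?_) g fun _ => rfl
  have h := ConstrComm.compdiag _ _ (hg i) (harr i j a)
  rwa [Category.assoc, hcomm i j a] at h

theorem constrArr_node {X : S.Theory} {n : S.Node} (g : X ⟶ S.univMod.obj n) : ConstrArr L g :=
  hom_node_induction (P := fun _ g => ConstrArr L g)
    (fun i => .proj X.diagram (fun _ => constrOb L _) (constrArr_diagram L X) _
      (isCanonical_formalCone L X) i)
    (fun f _ hg => .comp _ _ hg (.arr f))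
    (fun c g hg => constrArr_of_comp_proj L (fun _ _ _ => .arr _) (.sketch c)
      (S.univMod_isModel.2 c).1 g hg) g

theorem constrArr {X Y : S.Theory} (f : X ⟶ Y) : ConstrArr L f :=
  constrArr_of_comp_proj L (constrArr_diagram L Y) (isCanonical_formalCone L Y)
    Y.formalCone_isLimit.1 f fun i => constrArr_node L (n := Y.label i) _

end Rules

/-! ### Functors out of the theory -/

section Functors

variable {D : Type w} [Category.{v} D] {F G : S.Theory ⥤ D} {X : S.Theory}

theorem hom_ext_of_preservesFinLim (hG : PreservesFinLim G) {A : D} {f g : A ⟶ G.obj X}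
    (h : ∀ i, f ≫ G.map (X.proj i) = g ≫ G.map (X.proj i)) : f = g :=
  (hG _ _ _ X.formalCone_isLimit).hom_ext h

theorem exists_lift_of_preservesFinLim (hG : PreservesFinLim G) {A : D}
    (k : ∀ i, A ⟶ G.obj (S.univMod.obj (X.label i)))
    (hk : ∀ {i j : X.shape.Node} (a : i ⟶ j), k i ≫ G.map (S.univMod.map (X.arrow a)) = k j) :
    ∃ h : A ⟶ G.obj X, ∀ i, h ≫ G.map (X.proj i) = k i :=
  ((hG _ _ _ X.formalCone_isLimit).2 ⟨A, k⟩ fun i _ a =>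
    (congrArg (fun g => k i ≫ G.map g) (X.univMod_map_arrow a).symm).trans (hk a)).exists

variable {φ : ∀ n : S.Node, F.obj (S.univMod.obj n) ⟶ G.obj (S.univMod.obj n)}

theorem comp_map_eq_of_proj (hG : PreservesFinLim G)
    (hφ : ∀ {a b : S.Node} (f : a ⟶ b),
      F.map (S.univMod.map f) ≫ φ b = φ a ≫ G.map (S.univMod.map f))
    {Φ : F.obj X ⟶ G.obj X}
    (hΦ : ∀ i, Φ ≫ G.map (X.proj i) = F.map (X.proj i) ≫ φ (X.label i))
    {n : S.Node} (g : X ⟶ S.univMod.obj n) : Φ ≫ G.map g = F.map g ≫ φ n := by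
  refine hom_node_induction (P := fun n g => Φ ≫ G.map g = F.map g ≫ φ n) hΦ
    (fun f g hg => ?_) (fun c g hg => ?_) g
  · rw [F.map_comp, G.map_comp, Category.assoc, hφ, reassoc_of% hg]
  · refine (hG _ _ _ (S.univMod_isModel.2 c)).hom_ext fun i => ?_
    change (Φ ≫ G.map g) ≫ G.map (S.univMod.map ((S.cone c).proj i)) =
      (F.map g ≫ φ _) ≫ G.map (S.univMod.map ((S.cone c).proj i))
    rw [Category.assoc, Category.assoc, ← hφ, ← G.map_comp, hg i, F.map_comp, Category.assoc]

theorem exists_natTrans (hG : PreservesFinLim G)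
    (hφ : ∀ {a b : S.Node} (f : a ⟶ b),
      F.map (S.univMod.map f) ≫ φ b = φ a ≫ G.map (S.univMod.map f)) :
    ∃ Φ : F ⟶ G, ∀ (X : S.Theory) (i : X.shape.Node),
      Φ.app X ≫ G.map (X.proj i) = F.map (X.proj i) ≫ φ (X.label i) := by
  choose Φ hΦ using fun X : S.Theory => exists_lift_of_preservesFinLim hG (X := X)
    (fun i => F.map (X.proj i) ≫ φ (X.label i)) fun a => by
      rw [Category.assoc, ← hφ, ← F.map_comp_assoc, X.proj_comp_arrow]
  refine ⟨⟨Φ, fun X Y f => hom_ext_of_preservesFinLim hG fun i => ?_⟩, hΦ⟩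
  rw [Category.assoc, hΦ, ← F.map_comp_assoc, Category.assoc, ← G.map_comp,
    comp_map_eq_of_proj hG hφ (hΦ X)]

theorem nonempty_iso_of_univMod (hF : PreservesFinLim F) (hG : PreservesFinLim G)
    (φ : ∀ n : S.Node, F.obj (S.univMod.obj n) ≅ G.obj (S.univMod.obj n))
    (hφ : ∀ {a b : S.Node} (f : a ⟶ b),
      F.map (S.univMod.map f) ≫ (φ b).hom = (φ a).hom ≫ G.map (S.univMod.map f)) :
    Nonempty (F ≅ G) := by
  obtain ⟨Φ, hΦ⟩ := exists_natTrans hG hφ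
  obtain ⟨Ψ, hΨ⟩ := exists_natTrans hF (φ := fun n => (φ n).inv) fun f => by
    rw [Iso.eq_inv_comp, ← reassoc_of% hφ f, Iso.hom_inv_id, Category.comp_id]
  refine ⟨⟨Φ, Ψ, NatTrans.ext (funext fun X => hom_ext_of_preservesFinLim hF fun i => ?_),
    NatTrans.ext (funext fun X => hom_ext_of_preservesFinLim hG fun i => ?_)⟩⟩
  · rw [NatTrans.comp_app, NatTrans.id_app, Category.assoc, hΨ, reassoc_of% hΦ X i,
      Iso.hom_inv_id, Category.comp_id, Category.id_comp]
  · rw [NatTrans.comp_app, NatTrans.id_app, Category.assoc, hΦ, reassoc_of% hΨ X i,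
      Iso.inv_hom_id, Category.comp_id, Category.id_comp]

end Functors

/-! ### Systems of equations -/

section Systems

variable {V W : S.Node → Type} {M : S.SetModel}

/-- The assignments of values in a model to the variables of a context `V`, where `V n` is the type
of variables of sort `n`. -/
abbrev Asg (M : S.SetModel) (V : S.Node → Type) : Type u := ∀ n, V n → M.toPre.obj n

/-- The disjoint union of two contexts. -/
abbrev SumCtx (V W : S.Node → Type) (n : S.Node) : Type := V n ⊕ W n

/-- The common extension of assignments to the variables of two contexts. -/
def Asg.sum (x : Asg M V) (y : Asg M W) : Asg M (SumCtx V W) := fun n => Sum.elim (x n) (y n)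

theorem Asg.exists_eq_sum (z : Asg M (SumCtx V W)) :
    ∃ (x : Asg M V) (y : Asg M W), z = x.sum y :=
  ⟨fun n v => z n (.inl v), fun n w => z n (.inr w), funext fun _ => (Sum.elim_comp_inl_inr _).symm⟩

/-- The equations `f x = y` and `x = y` between variables. -/
inductive Eqn (V : S.Node → Type) : Type u
  | edge {a b : S.Node} (f : a ⟶ b) (x : V a) (y : V b) : Eqn V
  | eq {a : S.Node} (x y : V a) : Eqn V

/-- The assignment satisfies the equation. -/
def Eqn.Holds (z : Asg M V) : Eqn V → Prop
  | .edge f x y => M.toPre.map f (z _ x) = z _ y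
  | .eq x y => z _ x = z _ y

/-- Renaming of variables in an equation. -/
def Eqn.map (σ : ∀ n, V n → W n) : Eqn V → Eqn W
  | .edge f x y => .edge f (σ _ x) (σ _ y)
  | .eq x y => .eq (σ _ x) (σ _ y)

theorem Eqn.holds_map (σ : ∀ n, V n → W n) (z : Asg M W) (c : Eqn V) :
    (c.map σ).Holds z ↔ c.Holds fun n x => z n (σ n x) := by
  cases c <;> rfl

/-- The assignment is a solution of the system of equations. -/
def Solves (C : Set (Eqn V)) (z : Asg M V) : Prop := ∀ c ∈ C, c.Holds z

theorem solves_image {σ : ∀ n, V n → W n} {C : Set (Eqn V)} {z : Asg M W} :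
    Solves (Eqn.map σ '' C) z ↔ Solves C fun n x => z n (σ n x) :=
  Set.forall_mem_image.trans (forall₂_congr fun c _ => Eqn.holds_map σ z c)

theorem solves_iUnion {K : Sort*} {C : K → Set (Eqn V)} {z : Asg M V} :
    Solves (⋃ k, C k) z ↔ ∀ k, Solves (C k) z := by
  simp only [Solves, Set.mem_iUnion, forall_exists_index]
  exact forall_comm

end Systems

/-! ### Definable relations -/

section Definable

variable {V : S.Node → Type} {R R' : ∀ M : S.SetModel, Asg M V → Prop}

/-- A relation on the assignments to `V` is definable if it holds where a finite system of equations
in `V` and finitely many auxiliary variables has a solution, and the values of the auxiliary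
variables are always determined by those of `V`. -/
def Definable (R : ∀ M : S.SetModel, Asg M V → Prop) : Prop :=
  ∃ (W : S.Node → Type) (C : Set (Eqn (SumCtx V W))), Finite (Σ n, W n) ∧ C.Finite ∧
    ∀ M x, (R M x ↔ ∃ y : Asg M W, Solves C (x.sum y)) ∧
      { y : Asg M W | Solves C (x.sum y) }.Subsingleton

theorem Definable.congr (h : Definable R) (hR : ∀ M x, R' M x ↔ R M x) : Definable R' := by
  have : R' = R := funext fun M => funext fun x => propext (hR M x)
  rwa [this]

theorem definable_eqn (c : Eqn V) : Definable fun _ x => c.Holds x := by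
  have : IsEmpty (Σ _ : S.Node, Empty) := ⟨fun p => p.2.elim⟩
  refine ⟨fun _ => Empty, Eqn.map (fun _ => .inl) '' {c}, .of_subsingleton,
    (Set.finite_singleton c).image _, fun M x => ⟨?_, Set.subsingleton_of_subsingleton⟩⟩
  have hsol (y : Asg M fun _ => Empty) :
      Solves (Eqn.map (fun _ => .inl) '' {c}) (x.sum y) ↔ c.Holds x :=
    solves_image.trans forall_eq
  exact ⟨fun h => ⟨fun _ => Empty.elim, (hsol _).2 h⟩, fun ⟨y, hy⟩ => (hsol y).1 hy⟩

theorem definable_forall {K : Type} [Finite K] {R : K → ∀ M : S.SetModel, Asg M V → Prop}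
    (h : ∀ k, Definable (R k)) : Definable fun M x => ∀ k, R k M x := by
  choose W C hW hC hR using h
  let ι (k : K) (n : S.Node) : SumCtx V (W k) n → V n ⊕ Σ k, W k n := Sum.map id fun w => ⟨k, w⟩
  have hsol {M : S.SetModel} (x : Asg M V) (y : Asg M fun n => Σ k, W k n) :
      Solves (⋃ k, Eqn.map (ι k) '' C k) (x.sum y) ↔
        ∀ k, Solves (C k) (x.sum fun n w => y n ⟨k, w⟩) := by
    refine solves_iUnion.trans (forall_congr' fun k => solves_image.trans (iff_of_eq ?_))
    exact congrArg (Solves (C k)) (funext fun n => funext fun t => by cases t <;> rfl)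
  have hfin : Finite (Σ n, Σ k, W k n) := Finite.of_surjective
    (fun p : Σ k, Σ n, W k n => ⟨p.2.1, p.1, p.2.2⟩) fun ⟨n, k, w⟩ => ⟨⟨k, n, w⟩, rfl⟩
  refine ⟨fun n => Σ k, W k n, ⋃ k, Eqn.map (ι k) '' C k, hfin,
    Set.finite_iUnion fun k => (hC k).image _, fun M x => ⟨⟨fun hx => ?_, ?_⟩, ?_⟩⟩
  · choose y hy using fun k => (hR k M x).1.1 (hx k)
    exact ⟨fun n w => y w.1 n w.2, (hsol x _).2 hy⟩
  · rintro ⟨y, hy⟩ k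
    exact (hR k M x).1.2 ⟨_, (hsol x y).1 hy k⟩
  · intro y hy y' hy'
    funext n ⟨k, w⟩
    exact congrFun₂ ((hR k M x).2 ((hsol x y).1 hy k) ((hsol x y').1 hy' k)) n w

theorem Definable.and (h : Definable R) (h' : Definable R') :
    Definable fun M x => R M x ∧ R' M x :=
  (definable_forall (K := Bool) (R := fun k => bif k then R else R') fun k => by
    cases k <;> assumption).congr fun M x => by simp [and_comm]

theorem Definable.exists_sum {W : S.Node → Type} [Finite (Σ n, W n)]
    {R : ∀ M : S.SetModel, Asg M (SumCtx V W) → Prop} (h : Definable R)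
    (hR : ∀ M (x : Asg M V), { y | R M (x.sum y) }.Subsingleton) :
    Definable fun M (x : Asg M V) => ∃ y, R M (x.sum y) := by
  obtain ⟨W', C, hW', hC, hsol⟩ := h
  have hassoc {M : S.SetModel} (x : Asg M V) (y : Asg M W) (y' : Asg M W') :
      Solves (Eqn.map (fun n => Equiv.sumAssoc (V n) (W n) (W' n)) '' C) (x.sum (y.sum y')) ↔
        Solves C ((x.sum y).sum y') := by
    refine solves_image.trans (iff_of_eq (congrArg (Solves C) ?_))
    funext n t
    obtain (v | w) | w := t <;> rfl
  have hfin : Finite (Σ n, SumCtx W W' n) := .of_equiv _ (Equiv.sigmaSumDistrib W W').symm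
  refine ⟨SumCtx W W', Eqn.map (fun n => Equiv.sumAssoc (V n) (W n) (W' n)) '' C, hfin,
    hC.image _, fun M x => ⟨⟨?_, ?_⟩, ?_⟩⟩
  · rintro ⟨y, hy⟩
    obtain ⟨y', hy'⟩ := (hsol M _).1.1 hy
    exact ⟨y.sum y', (hassoc x y y').2 hy'⟩
  · rintro ⟨z, hz⟩
    obtain ⟨y, y', rfl⟩ := z.exists_eq_sum
    exact ⟨y, (hsol M _).1.2 ⟨y', (hassoc x y y').1 hz⟩⟩
  · intro z hz z' hz'
    obtain ⟨y₁, y₁', rfl⟩ := z.exists_eq_sum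
    obtain ⟨y₂, y₂', rfl⟩ := z'.exists_eq_sum
    have h₁ := (hassoc x y₁ y₁').1 hz
    have h₂ := (hassoc x y₂ y₂').1 hz'
    obtain rfl : y₁ = y₂ := hR M x ((hsol M _).1.2 ⟨_, h₁⟩) ((hsol M _).1.2 ⟨_, h₂⟩)
    rw [(hsol M _).2 h₁ h₂]

/-- The context with one variable of sort `l k` for each `k`. -/
inductive Var {K : Type} (l : K → S.Node) : S.Node → Type
  | mk (k : K) : Var l (l k)

instance {K : Type} [Finite K] (l : K → S.Node) : Finite (Σ n, Var l n) :=
  Finite.of_surjective (fun k => ⟨l k, .mk k⟩) fun ⟨_, .mk k⟩ => ⟨k, rfl⟩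

/-- The assignments to the variables of `Var l` are the families of values of the sorts `l k`. -/
def Var.asgEquiv {K : Type} (l : K → S.Node) (M : S.SetModel) :
    (∀ k, M.toPre.obj (l k)) ≃ Asg M (Var l) where
  toFun y := fun | _, .mk k => y k
  invFun z k := z _ (.mk k)
  left_inv _ := rfl
  right_inv _ := funext fun _ => funext fun | .mk _ => rfl

theorem Definable.exists_var {K : Type} [Finite K] {l : K → S.Node}
    {R : ∀ M : S.SetModel, Asg M (SumCtx V (Var l)) → Prop} (h : Definable R)
    (hR : ∀ M (x : Asg M V) y y', R M (x.sum (Var.asgEquiv l M y)) →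
      R M (x.sum (Var.asgEquiv l M y')) → y = y') :
    Definable fun M (x : Asg M V) => ∃ y, R M (x.sum (Var.asgEquiv l M y)) := by
  refine (h.exists_sum fun M x z hz z' hz' => ?_).congr fun M x =>
    ((Var.asgEquiv l M).surjective.exists (p := fun z => R M (x.sum z))).symm
  obtain ⟨y, rfl⟩ := (Var.asgEquiv l M).surjective z
  obtain ⟨y', rfl⟩ := (Var.asgEquiv l M).surjective z'
  rw [hR M x y y' hz hz']

end Definable

/-! ### Representability of definable relations -/

section Representable

variable {V : S.Node → Type}

/-- The assignment to `V` that is given by arrows `π` from `Z` to the nodes and an element of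
`lim (M ∘ Z)`. -/
def asgOf {Z : S.Theory} (π : ∀ n, V n → (Z ⟶ S.univMod.obj n)) (M : S.SetModel)
    (z : Sec M Z) : Asg M V :=
  fun n x => Theory.val (π n x) M z

/-- The object `Z` represents the relation `R` by the variables `π`: the elements of `lim (M ∘ Z)`
are the assignments that satisfy `R`. -/
def Represents (Z : S.Theory) (π : ∀ n, V n → (Z ⟶ S.univMod.obj n))
    (R : ∀ M : S.SetModel, Asg M V → Prop) : Prop :=
  ∀ M, Set.BijOn (asgOf π M) Set.univ { x | R M x }

theorem exists_represents_diagram {K : Type*} [Finite K] (l : K → S.Node) {A : K → K → Type*}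
    [∀ i j, Finite (A i j)] (m : ∀ {i j}, A i j → (l i ⟶ l j)) :
    ∃ (Z : S.Theory) (π : ∀ k, Z ⟶ S.univMod.obj (l k)), ∀ M : S.SetModel,
      Set.BijOn (fun z k => Theory.val (π k) M z) Set.univ
        { x | ∀ (i j : K) (a : A i j), M.toPre.map (m a) (x i) = x j } := by
  let e : Fin (Nat.card K) ≃ K := (Finite.equivFin K).symm
  let Z : S.Theory :=
    { shape := ⟨Nat.card K, fun i j => Nat.card (A (e i) (e j))⟩
      diag :=
        { obj := fun i => l (e i)
          map := fun a => S.toIm.map (m ((Finite.equivFin _).symm a)) } }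
  let π : ∀ k, Z ⟶ S.univMod.obj (l k) :=
    Equiv.piCongrLeft (fun k => Z ⟶ S.univMod.obj (l k)) e Z.proj
  have val_π (M) (z : Sec M Z) (i) : Theory.val (π (e i)) M z = z.1 i :=
    congrArg (fun g : Z ⟶ S.univMod.obj (l (e i)) => Theory.val g M z)
      (Equiv.piCongrLeft_apply_apply (fun k => Z ⟶ S.univMod.obj (l k)) e Z.proj i)
  refine ⟨Z, π, fun M => ⟨fun z _ i j a => ?_, fun z _ z' _ h => ?_, fun x hx => ?_⟩⟩
  · obtain ⟨i, rfl⟩ := e.surjective i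
    obtain ⟨j, rfl⟩ := e.surjective j
    obtain ⟨a, rfl⟩ := (Finite.equivFin _).symm.surjective a
    exact (congrArg _ (val_π M z i)).trans ((z.2 i j a).trans (val_π M z j).symm)
  · exact Subtype.ext (funext fun i =>
      (val_π M z i).symm.trans ((congrFun h (e i)).trans (val_π M z' i)))
  · refine ⟨⟨fun i => x (e i), fun i j a => hx _ _ _⟩, trivial, funext fun k => ?_⟩
    obtain ⟨i, rfl⟩ := e.surjective k
    exact val_π M _ i

theorem finite_setOf_edge_mem {C : Set (Eqn V)} (hC : C.Finite) (a b : S.Node) :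
    { f : a ⟶ b | ∃ x y, .edge f x y ∈ C }.Finite := by
  choose x y h using fun f : { f : a ⟶ b | ∃ x y, .edge f x y ∈ C } => f.2
  have := hC.to_subtype
  refine Finite.of_injective (β := C) (fun f => ⟨.edge f.1 (x f) (y f), h f⟩) fun f g hfg => ?_
  have hinj := Subtype.mk.inj hfg
  simp only [Eqn.edge.injEq, heq_eq_eq, true_and] at hinj
  exact Subtype.ext hinj.1

theorem exists_represents_solves [Finite (Σ n, V n)] {C : Set (Eqn V)} (hC : C.Finite) :
    ∃ (Z : S.Theory) (π : ∀ n, V n → (Z ⟶ S.univMod.obj n)),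
      Represents Z π fun _ z => Solves C z := by
  -- The equations `x = y` are built in by a quotient, as `S` need not have identity arrows.
  let r (n : S.Node) (x y : V n) : Prop := .eq x y ∈ C
  let mk (p : Σ n, V n) : Σ n, Quot (r n) := ⟨p.1, Quot.mk _ p.2⟩
  have hmk : mk.Surjective := fun ⟨n, q⟩ => by
    obtain ⟨x, rfl⟩ := Quot.exists_rep q
    exact ⟨⟨n, x⟩, rfl⟩
  have := Finite.of_surjective mk hmk
  let A (p q : Σ n, Quot (r n)) : Type u :=
    { f : p.1 ⟶ q.1 // ∃ x y, .edge f x y ∈ C ∧ Quot.mk _ x = p.2 ∧ Quot.mk _ y = q.2 }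
  have hA (p q : Σ n, Quot (r n)) : Finite (A p q) := (finite_setOf_edge_mem hC p.1 q.1).subset
    fun f ⟨x, y, h, _⟩ => ⟨x, y, h⟩
  obtain ⟨Z, π, hπ⟩ := exists_represents_diagram (A := A) Sigma.fst Subtype.val
  refine ⟨Z, fun n x => π (mk ⟨n, x⟩), fun M => Set.BijOn.comp
    (p := { z : Asg M V | Solves C z })
    (g := fun (z : ∀ q : Σ n, Quot (r n), M.toPre.obj q.1) n x => z (mk ⟨n, x⟩))
    ⟨fun z hz c hc => ?_, fun z _ z' _ h => ?_, fun z hz => ?_⟩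
    (hπ M)⟩
  · cases c with
    | edge f x y => exact hz (mk ⟨_, x⟩) (mk ⟨_, y⟩) ⟨f, x, y, hc, rfl, rfl⟩
    | @eq a x y =>
      exact congrArg (β := M.toPre.obj a) (fun q : Quot (r a) => z ⟨a, q⟩) (Quot.sound hc)
  · refine funext (hmk.forall.2 fun p => ?_)
    exact congrFun₂ h p.1 p.2
  · refine ⟨fun q => Quot.lift (z q.1) (fun x y h => hz (.eq x y) h) q.2, ?_, rfl⟩
    intro p q ⟨f, x, y, hc, hx, hy⟩
    simp only [← hx, ← hy]
    exact hz _ hc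

theorem Definable.exists_represents [Finite (Σ n, V n)] {R : ∀ M : S.SetModel, Asg M V → Prop}
    (h : Definable R) : ∃ (Z : S.Theory) (π : ∀ n, V n → (Z ⟶ S.univMod.obj n)),
      Represents Z π R := by
  obtain ⟨W, C, hW, hC, hsol⟩ := h
  have : Finite (Σ n, SumCtx V W n) := .of_equiv _ (Equiv.sigmaSumDistrib V W).symm
  obtain ⟨Z, π, hπ⟩ := exists_represents_solves hC
  refine ⟨Z, fun n v => π n (.inl v), fun M => Set.BijOn.comp
    (t := { z | Solves C z }) (p := { x | R M x })
    (g := fun z n v => z n (.inl v)) ⟨fun z hz => ?_, fun z hz z' hz' h => ?_, fun x hx => ?_⟩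
    (hπ M)⟩
  · obtain ⟨x, y, rfl⟩ := z.exists_eq_sum
    exact (hsol M x).1.2 ⟨y, hz⟩
  · obtain ⟨x, y, rfl⟩ := z.exists_eq_sum
    obtain ⟨x', y', rfl⟩ := z'.exists_eq_sum
    obtain rfl : x = x' := h
    rw [(hsol M x).2 hz hz']
  · obtain ⟨y, hy⟩ := (hsol M x).1.1 hx
    exact ⟨x.sum y, hy, rfl⟩

end Representable

/-! ### Graphs of arrows are definable -/

section Graphs

instance (I : FinGraph) : Finite I.Node := inferInstanceAs (Finite (Fin I.nodes))

instance (I : FinGraph) (i j : I.Node) : Finite (i ⟶ j) :=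
  inferInstanceAs (Finite (Fin (I.arrows i j)))

variable {V : S.Node → Type} {X : S.Theory} {n : S.Node} {ξ : ∀ i, V (X.label i)}
  {M : S.SetModel} {x : Asg M V} {s s' : Sec M X}

/-- The variables `ξ` take the values of the compatible family `s` over `X`. -/
def IsSec (ξ : ∀ i, V (X.label i)) (M : S.SetModel) (x : Asg M V) (s : Sec M X) : Prop :=
  ∀ i, s.1 i = x _ (ξ i)

theorem IsSec.unique (h : IsSec ξ M x s) (h' : IsSec ξ M x s') : s = s' :=
  Subtype.ext (funext fun i => (h i).trans (h' i).symm)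

theorem definable_isSec (ξ : ∀ i, V (X.label i)) :
    Definable fun M x => ∃ s, IsSec ξ M x s := by
  refine (definable_forall fun p : Σ i j : X.shape.Node, (i ⟶ j) =>
    definable_eqn (.edge (X.arrow p.2.2) (ξ p.1) (ξ p.2.1))).congr fun M x => ⟨?_, fun h => ?_⟩
  · rintro ⟨s, hs⟩ ⟨i, j, a⟩
    change M.toPre.map (X.arrow a) (x _ (ξ i)) = x _ (ξ j)
    rw [M.map_arrow, ← hs, ← hs]
    exact s.2 i j a
  · refine ⟨⟨fun i => x _ (ξ i), fun i j a => ?_⟩, fun _ => rfl⟩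
    rw [← M.map_arrow]
    exact h ⟨i, j, a⟩

/-- The variables `ξ` take the values of a compatible family over `X`, and `η` takes the value of
`g` at it. -/
def IsGraph (g : X ⟶ S.univMod.obj n) (ξ : ∀ i, V (X.label i)) (η : V n) (M : S.SetModel)
    (x : Asg M V) : Prop :=
  ∃ s, IsSec ξ M x s ∧ Theory.val g M s = x n η

/-- The graph of `g` is definable, in every context. -/
def HasDefinableGraph (g : X ⟶ S.univMod.obj n) : Prop :=
  ∀ ⦃V : S.Node → Type⦄ (ξ : ∀ i, V (X.label i)) (η : V n), Definable (IsGraph g ξ η)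

theorem hasDefinableGraph_proj (i : X.shape.Node) : HasDefinableGraph (X.proj i) := fun _ ξ η =>
  ((definable_isSec ξ).and (definable_eqn (.eq (ξ i) η))).congr fun _ _ =>
    ⟨fun ⟨s, hs, h⟩ => ⟨⟨s, hs⟩, (hs i).symm.trans h⟩,
      fun ⟨⟨s, hs⟩, h⟩ => ⟨s, hs, (hs i).trans h⟩⟩

theorem HasDefinableGraph.comp_univMod {a b : S.Node} {g : X ⟶ S.univMod.obj a}
    (hg : HasDefinableGraph g) (f : a ⟶ b) : HasDefinableGraph (g ≫ S.univMod.map f) := by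
  intro V ξ η
  have hdef := (hg (V := SumCtx V (Var fun _ : Unit => a)) (fun i => .inl (ξ i))
    (.inr (.mk ()))).and (definable_eqn (.edge f (.inr (.mk ())) (.inl η)))
  refine (hdef.exists_var fun M x y y' => ?_).congr fun M x => ⟨?_, ?_⟩
  · rintro ⟨⟨s, hs, h⟩, -⟩ ⟨⟨s', hs', h'⟩, -⟩
    obtain rfl : s = s' := IsSec.unique (ξ := ξ) (x := x) hs hs'
    exact funext fun _ => h.symm.trans h'
  · rintro ⟨s, hs, h⟩
    exact ⟨fun _ => Theory.val g M s, ⟨s, hs, rfl⟩, h⟩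
  · rintro ⟨y, ⟨s, hs, h⟩, h'⟩
    exact ⟨s, hs, (congrArg (M.toPre.map f) h).trans h'⟩

theorem SetModel.ext_cone (M : S.SetModel) (c : S.ConeIdx) {z z' : M.toPre.obj (S.cone c).vertex}
    (h : ∀ k, M.toPre.map ((S.cone c).proj k) z = M.toPre.map ((S.cone c).proj k) z') : z = z' := by
  have hlim := (GCone.isLimit_type_iff _).1 (M.isModel.2 c)
  exact (hlim.2 _ fun i j a => ConcreteCategory.congr_hom (hlim.1 i j a) z').unique h fun _ => rfl

theorem hasDefinableGraph_of_comp_cone (c : S.ConeIdx) {g : X ⟶ S.univMod.obj (S.cone c).vertex}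
    (hg : ∀ k, HasDefinableGraph (g ≫ S.univMod.map ((S.cone c).proj k))) :
    HasDefinableGraph g := by
  intro V ξ η
  let ξ' (i : X.shape.Node) : SumCtx V (Var (S.coneBase c).obj) (X.label i) := .inl (ξ i)
  have hdef := (definable_isSec ξ').and (definable_forall fun k =>
    (hg k ξ' (.inr (.mk k))).and
      (definable_eqn (.edge ((S.cone c).proj k) (.inl η) (.inr (.mk k)))))
  refine (hdef.exists_var fun M x y y' => ?_).congr fun M x => ⟨?_, ?_⟩
  · rintro ⟨-, h⟩ ⟨-, h'⟩
    exact funext fun k => (h k).2.symm.trans (h' k).2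
  · rintro ⟨s, hs, h⟩
    exact ⟨fun k => M.toPre.map ((S.cone c).proj k) (x _ η), ⟨s, hs⟩, fun k =>
      ⟨⟨s, hs, congrArg (M.toPre.map ((S.cone c).proj k)) h⟩, rfl⟩⟩
  · rintro ⟨y, ⟨s, hs⟩, h⟩
    refine ⟨s, hs, M.ext_cone c fun k => ?_⟩
    obtain ⟨⟨s', hs', hk⟩, hη⟩ := h k
    obtain rfl := hs.unique hs'
    exact hk.trans hη.symm

theorem hasDefinableGraph (g : X ⟶ S.univMod.obj n) : HasDefinableGraph g :=
  hom_node_induction (P := fun _ g => HasDefinableGraph g) hasDefinableGraph_proj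
    (fun f _ hg => hg.comp_univMod f) (fun c _ hg => hasDefinableGraph_of_comp_cone c hg) g

theorem definable_isSec_act {Y : S.Theory} (f : X ⟶ Y) (ξ : ∀ i, V (X.label i))
    (η : ∀ i, V (Y.label i)) :
    Definable fun M x => ∃ s, IsSec ξ M x s ∧ IsSec η M x (Theory.act f M s) := by
  refine ((definable_isSec ξ).and (definable_forall fun k =>
    hasDefinableGraph (f ≫ Y.proj k) ξ (η k))).congr fun M x => ⟨?_, ?_⟩
  · rintro ⟨s, hs, h⟩
    exact ⟨⟨s, hs⟩, fun k => ⟨s, hs, h k⟩⟩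
  · rintro ⟨⟨s, hs⟩, h⟩
    refine ⟨s, hs, fun k => ?_⟩
    obtain ⟨s', hs', hk⟩ := h k
    obtain rfl := hs.unique hs'
    exact hk

theorem definable_isCompatible {I : FinGraph} (δ : I.Node ⥤q S.Theory)
    (ξ : ∀ i k, V ((δ.obj i).label k)) :
    Definable fun M x => ∃ s : ∀ i, Sec M (δ.obj i), (∀ i, IsSec (ξ i) M x (s i)) ∧
      ∀ (i j : I.Node) (a : i ⟶ j), Theory.act (δ.map a) M (s i) = s j := by
  refine ((definable_forall fun i => definable_isSec (ξ i)).and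
    (definable_forall fun p : Σ i j : I.Node, (i ⟶ j) =>
      definable_isSec_act (δ.map p.2.2) (ξ p.1) (ξ p.2.1))).congr fun M x => ⟨?_, ?_⟩
  · rintro ⟨s, hs, h⟩
    refine ⟨fun i => ⟨s i, hs i⟩, fun ⟨i, j, a⟩ => ⟨s i, hs i, ?_⟩⟩
    rw [h i j a]
    exact hs j
  · rintro ⟨h, hmap⟩
    choose s hs using h
    refine ⟨s, hs, fun i j a => ?_⟩
    obtain ⟨s', hs', h⟩ := hmap ⟨i, j, a⟩
    obtain rfl := hs'.unique (hs i)
    exact h.unique (hs j)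

end Graphs

/-! ### Finite limits in the theory -/

theorem exists_evalAt_isLimit {I : FinGraph} (δ : I.Node ⥤q S.Theory) :
    ∃ c : GCone δ, ∀ M : S.SetModel, (c.map (evalAt M).toPrefunctor).IsLimit := by
  let l (p : Σ i : I.Node, (δ.obj i).shape.Node) : S.Node := (δ.obj p.1).label p.2
  let ξ (i k) : Var l ((δ.obj i).label k) := .mk (l := l) ⟨i, k⟩
  obtain ⟨Z, π, hπ⟩ := (definable_isCompatible δ ξ).exists_represents
  choose s hs hcomm using fun M (z : Sec M Z) => (hπ M).mapsTo (Set.mem_univ z)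
  let proj (i : I.Node) : Z ⟶ δ.obj i := TheoryHom.mk (fun M z => s M z i) fun {M N} h z =>
    (hs N _ i).unique fun k => (congrArg (h.app _) (hs M z i k)).trans
      (Theory.val_naturality (π _ (ξ i k)) h z).symm
  refine ⟨⟨Z, proj⟩, fun M => (GCone.isLimit_type_iff _).2 ⟨fun i j a => ?_, fun x hx => ?_⟩⟩
  · ext z
    exact hcomm M z i j a
  · let y : Asg M (Var l) := Var.asgEquiv l M fun p => (x p.1 : Sec M (δ.obj p.1)).1 p.2
    have hy (i : I.Node) : IsSec (ξ i) M y (x i) := fun _ => rfl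
    obtain ⟨z, -, hz⟩ := (hπ M).surjOn (show y ∈ _ from ⟨x, hy, hx⟩)
    refine ⟨z, fun i => (hs M z i).unique (hz ▸ hy i), fun z' hz' => ?_⟩
    refine (hπ M).injOn (Set.mem_univ _) (Set.mem_univ _) (Eq.trans ?_ hz.symm)
    funext _ ⟨i, k⟩
    exact (hs M z' i k).symm.trans (congrArg (fun t : Sec M (δ.obj i) => t.1 k) (hz' i))

theorem evalAt_preservesFinLim (M : S.SetModel) : PreservesFinLim (evalAt M) :=
  preservesFinLim_of_exists fun _ δ =>
    (exists_evalAt_isLimit δ).imp fun c hc => ⟨isLimit_of_evalAt c hc, hc M⟩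

theorem isCategorialTheory (S : FinLimSketch.{u}) : S.IsCategorialTheory S.univMod where
  hasLimits _ δ := (exists_evalAt_isLimit δ).imp isLimit_of_evalAt
  isModel := S.univMod_isModel
  extend M := ⟨evalAt M, evalAt_preservesFinLim M, evalAtUnivModIso M, fun _ => rfl⟩
  unique _ _ hF hG := fun ⟨φ, hφ⟩ => nonempty_iso_of_univMod hF hG φ hφ

/-! ### Canonical limits -/

theorem single_injective : Function.Injective S.single := fun m n h => by
  obtain ⟨-, h⟩ := Theory.mk.inj h
  exact congrArg (fun d : FinGraph.point.Node ⥤q S.ImNode => d.obj FinGraph.pointNode)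
    (eq_of_heq h)

theorem imIncl_map_injective {a b : S.ImNode} :
    Function.Injective (S.imIncl.map : (a ⟶ b) → _) := by
  rintro ⟨f⟩ ⟨g⟩ h
  refine Quotient.sound fun M => ?_
  ext x
  exact congrArg (fun e => Theory.val (n := b) e M (secSingle (n := a) M x)) h

theorem comp_imIncl_injective {J : Type*} [Quiver J] :
    Function.Injective fun d : J ⥤q S.ImNode => d ⋙q S.imIncl := by
  rintro ⟨obj, map⟩ ⟨obj', map'⟩ h
  obtain rfl : obj = obj' := funext fun i => single_injective (Prefunctor.congr_obj h i)
  obtain ⟨-, h⟩ := Prefunctor.mk.inj h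
  congr
  funext i j a
  exact imIncl_map_injective (congrFun₃ (eq_of_heq h) i j a)

theorem Theory.diagram_injective :
    Function.Injective fun X : S.Theory =>
      (⟨X.shape, X.diagram⟩ : Σ I : FinGraph, I.Node ⥤q S.Theory) := by
  rintro ⟨I, d⟩ ⟨J, d'⟩ h
  obtain ⟨rfl, h⟩ := Sigma.mk.inj h
  exact congrArg (Theory.mk I) (comp_imIncl_injective (eq_of_heq h))

theorem nonempty_canonicalLimits (S : FinLimSketch.{u}) : Nonempty S.CanonicalLimits := by
  let LimitCone (p : Σ I : FinGraph, I.Node ⥤q S.Theory) := { c : GCone p.2 // c.IsLimit }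
  have hex (p : Σ I : FinGraph, I.Node ⥤q S.Theory) : Nonempty (LimitCone p) :=
    nonempty_subtype.2 (S.isCategorialTheory.hasLimits p.1 p.2)
  obtain ⟨L, hL⟩ := exists_pi_extension (P := LimitCone) Theory.diagram_injective
    fun X => ⟨X.formalCone, X.formalCone_isLimit⟩
  exact ⟨⟨fun δ => (L ⟨_, δ⟩).1, fun δ => (L ⟨_, δ⟩).2, fun X => congrArg Subtype.val (hL X)⟩⟩

end FinLimSketch

theorem proposition4p1p1 (S : FinLimSketch.{u}) :
    S.IsCategorialTheory S.univMod ∧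
    Nonempty S.CanonicalLimits ∧
    ∀ L : S.CanonicalLimits,
      (∀ X : S.Theory, FinLimSketch.ConstrOb L X) ∧
      (∀ (X Y : S.Theory) (f : X ⟶ Y), FinLimSketch.ConstrArr L f) :=
  ⟨S.isCategorialTheory, S.nonempty_canonicalLimits, fun L =>
    ⟨FinLimSketch.constrOb L, fun _ _ => FinLimSketch.constrArr L⟩⟩
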